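/- Let $r\ge 2$ and $\mathcal A=\{0,\dots,r-1\}$. Let $\Omega=\mathcal A^{\mathbb N}$ carry the metric $d(x,y)=2^{-\min\{n\ge 1:\,x_n\ne y_n\}}$ for $x\neq y$, $d(x,x)=0$, and its Borel $\sigma$-algebra, and write $ax=(a,x_1,x_2,\dots)$ for $a\in\mathcal A$ and $x=(x_1,x_2,\dots)\in\Omega$. Let $\beta>0$, $\mu<0$, $M>0$, and let $A_N:\Omega\to\mathbb R$, $N\in\mathbb N_0=\{0,1,2,\dots\}$, be functions such that (H1) $|A_N(x)-A_N(y)|\le M\,d(x,y)$ for all $x,y\in\Omega$ and all $N\in\mathbb N_0$; (H3) $A_N(x)>\left(\frac{\log r}{\beta}+\mu\right)N$ for all $x\in\Omega$ and all $N\in\mathbb N_0$. Then the grand-canonical-Ruelle operator $$\mathcal L_{\beta,\mu}(f)(x)=\sum_{N\in\mathbb N_0}e^{\beta\mu N}\sum_{a\in\mathcal A}e^{-\beta A_N(ax)}f(ax)$$ is a well-defined bounded linear operator on $C(\Omega)=C(\Omega,\mathbb R)$ with the supremum norm (the series converges for all $f\in C(\Omega)$ and $x\in\Omega$). It is the transfer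 operator of the countable IFS with continuous weights $(\Omega,\phi_j,q_j)_{j\in\mathbb N_0}$, that is, $\mathcal L_{\beta,\mu}(f)(x)=\sum_{j\in\mathbb N_0}e^{q_j(x)}f(\phi_j(x))$, where $\phi_j(x)=(j\bmod r)\,x$ and $q_j(x)=-\beta\,\bigl(A_{\xi(j)}(\phi_j(x))-\xi(j)\mu\bigr)$ with $\xi(j)=\frac{j-(j\bmod r)}{r}$. Moreover, let $\mathcal L_{\beta,\mu}^*:C(\Omega)^*\to C(\Omega)^*$, $(\mathcal L_{\beta,\mu}^*\nu)(f)=\nu(\mathcal L_{\beta,\mu}f)$, be the dual operator, where a Borel probability measure $\nu$ is identified with the functional $f\mapsto\int f\,d\nu$. Then there is a Borel probability measure $\nu_q$ on $\Omega$ such that, with $\lambda:=\mathcal L_{\beta,\mu}^*(\nu_q)(1)$, $$\mathcal L_{\beta,\mu}^*(\nu_q)=\lambda\,\nu_q ,$$ and $\lambda$ is an eigenvalue of $\mathcal L_{\beta,\mu}^*$. -/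

import Mathlib

open MeasureTheory

noncomputable section

namespace GrandCanonical

/-- The symbolic space `{0, …, r-1}^ℕ`, with the product topology and its Borel σ-algebra.
The metric `symDist` below induces this topology. Index `n : ℕ` stands for the letter
`x_{n+1}` of a sequence `(x_1, x_2, …)`. -/
abbrev Omega (r : ℕ) : Type := ℕ → Fin r

open Classical in
/-- The metric `d(x, y) = 2^{-min {n ≥ 1 : x_n ≠ y_n}}` for `x ≠ y`, and `d(x, x) = 0`.
As sequences are indexed from `0` here, the first differing position counted from `1` is
`PiNat.firstDiff x y + 1`. -/
def symDist {r : ℕ} (x y : Omega r) : ℝ :=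
  if x = y then 0 else (2 : ℝ)⁻¹ ^ (PiNat.firstDiff x y + 1)

/-- The concatenation `a x = (a, x_1, x_2, …)`. -/
def prepend {r : ℕ} (a : Fin r) (x : Omega r) : Omega r
  | 0 => a
  | n + 1 => x n

/-- The family `(A_N)` is uniformly Lipschitz: every `A_N` has Lipschitz constant at most `M`. -/
def UniformlyLipschitz {r : ℕ} (A : ℕ → Omega r → ℝ) (M : ℝ) : Prop :=
  ∀ N x y, |A N x - A N y| ≤ M * symDist x y

/-- Strong superlinearity with constants `K` and `δ ≥ 0`. -/
def StrongSuperlinear {r : ℕ} (A : ℕ → Omega r → ℝ) (K δ : ℝ) : Prop :=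
  0 ≤ δ ∧ ∀ (x : Omega r) (N : ℕ), K * (N : ℝ) + δ < A N x

/-- The `N`-th term `e^{β μ N} ∑_{a} e^{-β A_N(ax)} f(ax)` of the grand-canonical-Ruelle
operator. -/
def ruelleTerm {r : ℕ} (A : ℕ → Omega r → ℝ) (β μ : ℝ) (f : Omega r → ℝ) (x : Omega r)
    (N : ℕ) : ℝ :=
  Real.exp (β * μ * N) * ∑ a : Fin r, Real.exp (-β * A N (prepend a x)) * f (prepend a x)

/-- `L` is the grand-canonical-Ruelle operator `𝓛_{β, μ}` of the family `A`, as a bounded operator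
on `C(Ω)`: the defining series converges at every point, with sum `L f x`.
These conditions determine `L`. -/
def IsGrandCanonicalRuelle {r : ℕ} (A : ℕ → Omega r → ℝ) (β μ : ℝ)
    (L : C(Omega r, ℝ) →L[ℝ] C(Omega r, ℝ)) : Prop :=
  ∀ (f : C(Omega r, ℝ)) (x : Omega r), HasSum (ruelleTerm A β μ f x) (L f x)

/-- `L` is the transfer operator `B_q(g)(x) = ∑_j e^{q_j(x)} g(φ_j(x))` of the countable IFS with
weights `(X, φ_j, q_j)_{j ∈ ℕ}`, whose maps and weights are continuous. -/
def IsTransferOperator {X : Type*} [TopologicalSpace X] [CompactSpace X]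
    (φ : ℕ → X → X) (q : ℕ → X → ℝ) (L : C(X, ℝ) →L[ℝ] C(X, ℝ)) : Prop :=
  (∀ j, Continuous (φ j)) ∧ (∀ j, Continuous (q j)) ∧
    ∀ (g : C(X, ℝ)) (x : X), HasSum (fun j => Real.exp (q j x) * g (φ j x)) (L g x)

/-- The maps `φ_j(x) = (j mod r) x`, `j ∈ ℕ`. -/
def ifsMap (r : ℕ) [NeZero r] (j : ℕ) (x : Omega r) : Omega r :=
  prepend (Fin.ofNat r j) x

/-- The weights `q_j(x) = -β (A_{ξ(j)}(φ_j(x)) - ξ(j) μ)`, with `ξ(j) = (j - (j mod r)) / r`. -/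
def ifsWeight {r : ℕ} [NeZero r] (A : ℕ → Omega r → ℝ) (β μ : ℝ) (j : ℕ) (x : Omega r) : ℝ :=
  -β * (A ((j - j % r) / r) (ifsMap r j x) - (((j - j % r) / r : ℕ) : ℝ) * μ)

/-- The functional `f ↦ ∫ f dν` on `C(X)`, an element of `C(X)*`. -/
def toDual {X : Type*} [TopologicalSpace X] [CompactSpace X] [MeasurableSpace X] [BorelSpace X]
    (ν : ProbabilityMeasure X) : StrongDual ℝ C(X, ℝ) :=
  LinearMap.mkContinuous
    { toFun := fun f => ∫ x, f x ∂(ν : Measure X)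
      map_add' := fun f g => by
        simpa using integral_add
          (f.continuous.integrable_of_hasCompactSupport (HasCompactSupport.of_compactSpace _))
          (g.continuous.integrable_of_hasCompactSupport (HasCompactSupport.of_compactSpace _))
      map_smul' := fun c f => by simp [integral_const_mul] }
    1 (fun f => by
      have h := norm_integral_le_of_norm_le_const (μ := (ν : Measure X)) (f := fun x => f x)
        (C := ‖f‖) (Filter.Eventually.of_forall fun x => f.norm_coe_le_norm x)
      simpa using h)

/-- The dual operator `L* : C(X)* → C(X)*`, `(L* ν)(f) = ν (L f)`. -/
def dualOp {X : Type*} [TopologicalSpace X] [CompactSpace X]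
    (L : C(X, ℝ) →L[ℝ] C(X, ℝ)) : StrongDual ℝ C(X, ℝ) →L[ℝ] StrongDual ℝ C(X, ℝ) :=
  ContinuousLinearMap.precomp ℝ L

end GrandCanonical

end

open MeasureTheory

namespace GrandCanonical

section PositiveOperator

variable {X : Type*} [TopologicalSpace X]

/-! Superlinearity bounds the Boltzmann weight of a pair `(N, a)` by `r⁻ᴺ`, so the series over `ℕ ×
Fin r` converges normally to a positive operator `L`. Summing over `a` first gives the Ruelle
series; the bijection `j ↦ (j / r, j % r)` gives the IFS. The eigenmeasure needs only positivity of
`L`. Let `l` be the infimum of the levels admitting a strictly positive strict supersolution. By the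
maximum principle, the range of `l - L` misses the open cone of positive functions. Hahn–Banach then
yields a positive functional that kills this range, and Riesz–Markov makes it a measure. -/

lemma convex_setOf_forall_pos : Convex ℝ {f : C(X, ℝ) | ∀ x, 0 < f x} := by
  intro f hf g hg a b ha hb hab x
  have h : 0 < a • f x + b • g x := (convex_Ioi (0 : ℝ)) (hf x) (hg x) ha hb hab
  simpa using h

variable [CompactSpace X]

lemma exists_pos_forall_le (f : C(X, ℝ)) (hf : ∀ x, 0 < f x) : ∃ c > 0, ∀ x, c ≤ f x := by
  rcases isEmpty_or_nonempty X with h | h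
  · exact ⟨1, one_pos, fun x => isEmptyElim x⟩
  · obtain ⟨x₀, -, hx₀⟩ := isCompact_univ.exists_isMinOn Set.univ_nonempty
      (f.continuous.continuousOn (s := Set.univ))
    exact ⟨f x₀, hf x₀, fun x => hx₀ (Set.mem_univ x)⟩

lemma isOpen_setOf_forall_pos : IsOpen {f : C(X, ℝ) | ∀ x, 0 < f x} := by
  simpa [Set.MapsTo] using
    ContinuousMap.isOpen_setOfPred_mapsTo (isCompact_univ (X := X)) (isOpen_Ioi (a := (0 : ℝ)))

/-- Maximum principle: if `L` is positive and has a strictly positive strict supersolution `u`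
at level `l`, then `l • g - L g > 0` forces `g ≥ 0`. -/
lemma nonneg_of_forall_lt {L : C(X, ℝ) →L[ℝ] C(X, ℝ)}
    (hL : ∀ f : C(X, ℝ), (∀ x, 0 ≤ f x) → ∀ x, 0 ≤ L f x) {l : ℝ} {u g : C(X, ℝ)}
    (hu : ∀ x, 0 < u x) (hLu : ∀ x, L u x < l * u x) (hg : ∀ x, L g x < l * g x) (x : X) :
    0 ≤ g x := by
  have hcont : Continuous fun y => g y / u y :=
    g.continuous.div u.continuous fun y => (hu y).ne'
  obtain ⟨x₀, -, hx₀⟩ := isCompact_univ.exists_isMinOn ⟨x, Set.mem_univ x⟩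
    (hcont.continuousOn (s := Set.univ))
  by_contra! hneg
  -- The least `t` with `g + t • u ≥ 0`: this function vanishes at `x₀`, where `L (g + t • u) ≥ 0`
  -- contradicts the two strict inequalities.
  set t := -(g x₀ / u x₀) with ht
  have hmin : ∀ y, -t ≤ g y / u y := fun y => by
    simpa [ht] using hx₀ (Set.mem_univ y)
  have htpos : 0 < t := by
    have := hmin x
    have h2 : g x / u x < 0 := div_neg_of_neg_of_pos hneg (hu x)
    linarith
  have hnonneg : ∀ y, 0 ≤ (g + t • u) y := fun y => by
    have := (le_div_iff₀ (hu y)).1 (hmin y)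
    simp only [ContinuousMap.add_apply, ContinuousMap.smul_apply, smul_eq_mul]
    linarith
  have hzero : g x₀ + t * u x₀ = 0 := by
    rw [ht]
    field_simp [(hu x₀).ne']
    ring
  have h1 := hL _ hnonneg x₀
  simp only [map_add, map_smul, ContinuousMap.add_apply, ContinuousMap.smul_apply,
    smul_eq_mul] at h1
  have h2 := mul_lt_mul_of_pos_left (hLu x₀) htpos
  have h3 := hg x₀
  have h4 : l * g x₀ + t * (l * u x₀) = 0 := by
    rw [show l * g x₀ + t * (l * u x₀) = l * (g x₀ + t * u x₀) by ring, hzero, mul_zero]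
  linarith

/-- For a positive operator `L` on `C(X)` there is a level `l` at which `l - L` never takes a
strictly positive value. -/
lemma exists_forall_exists_le [Nonempty X] {L : C(X, ℝ) →L[ℝ] C(X, ℝ)}
    (hL : ∀ f : C(X, ℝ), (∀ x, 0 ≤ f x) → ∀ x, 0 ≤ L f x) :
    ∃ l : ℝ, ∀ g : C(X, ℝ), ∃ x, l * g x ≤ L g x := by
  let S : Set ℝ := {l | ∃ u : C(X, ℝ), (∀ x, 0 < u x) ∧ ∀ x, L u x < l * u x}
  have hne : S.Nonempty := by
    refine ⟨‖L 1‖ + 1, 1, fun x => by simp, fun x => ?_⟩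
    have := (le_abs_self _).trans ((L 1).norm_coe_le_norm x)
    simp only [ContinuousMap.one_apply, mul_one]
    linarith
  have hbdd : BddBelow S := by
    refine ⟨0, fun l ⟨u, hu, hLu⟩ => ?_⟩
    obtain ⟨x⟩ := ‹Nonempty X›
    have h := (hL u (fun y => (hu y).le) x).trans_lt (hLu x)
    exact (pos_of_mul_pos_left h (hu x).le).le
  refine ⟨sInf S, fun g => ?_⟩
  by_contra! hg
  -- By compactness the strict inequality survives small shifts of the level. An upward shift
  -- reaches some level in `S` and forces `g ≥ 0`; a downward shift then contradicts the infimum.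
  have hpert : ∃ ε > 0, ∀ x, ∀ s : ℝ, |s| ≤ ε → L g x < (sInf S + s) * g x := by
    obtain ⟨c, hc, hcg⟩ := exists_pos_forall_le (sInf S • g - L g) fun x => by
      simpa using hg x
    refine ⟨c / (2 * (‖g‖ + 1)), by positivity, fun x s hs => ?_⟩
    have h1 := hcg x
    simp only [ContinuousMap.sub_apply, ContinuousMap.smul_apply, smul_eq_mul] at h1
    have h2 : |s * g x| ≤ c / 2 := by
      rw [abs_mul]
      calc |s| * |g x| ≤ c / (2 * (‖g‖ + 1)) * (‖g‖ + 1) := by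
            gcongr
            exact (g.norm_coe_le_norm x).trans (by linarith)
        _ = c / 2 := by field_simp
    have h3 := (abs_le.1 h2).1
    linarith
  obtain ⟨ε, hε, hgε⟩ := hpert
  obtain ⟨l, ⟨u, hu, hLu⟩, hlt⟩ := exists_lt_of_csInf_lt hne (lt_add_of_pos_right (sInf S) hε)
  have hle : sInf S ≤ l := csInf_le hbdd ⟨u, hu, hLu⟩
  have hgl : ∀ x, L g x < l * g x := fun x => by
    have := hgε x (l - sInf S) (by rw [abs_of_nonneg] <;> linarith)
    simpa using this
  have hg0 := nonneg_of_forall_lt hL hu hLu hgl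
  have hgpos : ∀ x, 0 < g x := fun x => by
    refine (hg0 x).lt_of_ne fun h => ?_
    have h1 := (hL g hg0 x).trans_lt (hg x)
    simp [← h] at h1
  have hmem : sInf S + -ε ∈ S :=
    ⟨g, hgpos, fun x => hgε x (-ε) (by rw [abs_neg, abs_of_pos hε])⟩
  linarith [csInf_le hbdd hmem]

/-- The dual of a positive operator on `C(X)` has a positive normalized eigenfunctional. -/
lemma exists_positive_eigenfunctional [Nonempty X] {L : C(X, ℝ) →L[ℝ] C(X, ℝ)}
    (hL : ∀ f : C(X, ℝ), (∀ x, 0 ≤ f x) → ∀ x, 0 ≤ L f x) :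
    ∃ (l : ℝ) (φ : StrongDual ℝ C(X, ℝ)), (∀ f : C(X, ℝ), (∀ x, 0 ≤ f x) → 0 ≤ φ f) ∧
      φ 1 = 1 ∧ ∀ f, φ (L f) = l * φ f := by
  obtain ⟨l, hl⟩ := exists_forall_exists_le hL
  let T : C(X, ℝ) →ₗ[ℝ] C(X, ℝ) := l • LinearMap.id - (L : C(X, ℝ) →ₗ[ℝ] C(X, ℝ))
  have hT : ∀ g, T g = l • g - L g := fun g => rfl
  have hdisj : Disjoint {f : C(X, ℝ) | ∀ x, 0 < f x} (LinearMap.range T : Set C(X, ℝ)) := by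
    rw [Set.disjoint_left]
    rintro _ hf ⟨g, rfl⟩
    obtain ⟨x, hx⟩ := hl g
    have h := hf x
    rw [hT] at h
    simp only [ContinuousMap.sub_apply, ContinuousMap.smul_apply, smul_eq_mul] at h
    linarith
  obtain ⟨ψ, c, hψ, hc⟩ := geometric_hahn_banach_open convex_setOf_forall_pos
    isOpen_setOf_forall_pos (LinearMap.range T).convex hdisj
  have hc0 : c ≤ 0 := by simpa using hc 0 (Submodule.zero_mem _)
  -- A linear functional bounded below on a subspace vanishes there; otherwise rescaling gives the
  -- value `c - 1`.
  have hrange : ∀ g, ψ (T g) = 0 := fun g => by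
    by_contra hne
    have h := hc (T (((c - 1) / ψ (T g)) • g)) ⟨_, rfl⟩
    rw [map_smul, map_smul, smul_eq_mul, div_mul_cancel₀ _ hne] at h
    linarith
  have hpos : ∀ f : C(X, ℝ), (∀ x, 0 < f x) → 0 < -ψ f := fun f hf => by
    linarith [hψ f hf]
  have hone : 0 < -ψ 1 := hpos 1 fun x => by simp
  refine ⟨l, (-ψ 1)⁻¹ • -ψ, fun f hf => ?_, ?_, fun f => ?_⟩
  · refine mul_nonneg (inv_nonneg.2 hone.le) (le_of_forall_pos_le_add fun ε hε => ?_)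
    -- The constant is chosen so that `-ψ` of the perturbation is exactly `ε`.
    have h := hpos (f + (ε / -ψ 1) • 1) fun x => by
      have : 0 < ε / -ψ 1 := div_pos hε hone
      simp only [ContinuousMap.add_apply, ContinuousMap.smul_apply, ContinuousMap.one_apply,
        smul_eq_mul, mul_one]
      linarith [hf x]
    have h2 : ε / -ψ 1 * ψ 1 = -ε := by
      have : ψ 1 ≠ 0 := by linarith
      field_simp
    rw [map_add, map_smul, smul_eq_mul, h2] at h
    change 0 ≤ -ψ f + ε
    linarith
  · simpa using inv_mul_cancel₀ hone.ne'
  · have h := hrange f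
    rw [hT, map_sub, map_smul, smul_eq_mul] at h
    have h' : ψ (L f) = l * ψ f := by linarith
    simp only [smul_apply, neg_apply, smul_eq_mul, h']
    ring

variable [T2Space X] [MeasurableSpace X] [BorelSpace X]

lemma exists_probabilityMeasure_toDual_eq (φ : StrongDual ℝ C(X, ℝ))
    (hφ : ∀ f : C(X, ℝ), (∀ x, 0 ≤ f x) → 0 ≤ φ f) (hone : φ 1 = 1) :
    ∃ ν : ProbabilityMeasure X, toDual ν = φ := by
  let Λ : CompactlySupportedContinuousMap X ℝ →ₚ[ℝ] ℝ := PositiveLinearMap.mk₀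
    { toFun := fun f => φ f.toContinuousMap
      map_add' := fun f g => φ.map_add f.toContinuousMap g.toContinuousMap
      map_smul' := fun c f => φ.map_smul c f.toContinuousMap }
    fun f hf => hφ _ hf
  have hint : ∀ f : C(X, ℝ), ∫ x, f x ∂(RealRMK.rieszMeasure Λ) = φ f := fun f =>
    RealRMK.integral_rieszMeasure Λ (CompactlySupportedContinuousMap.continuousMapEquiv f)
  have hprob : IsProbabilityMeasure (RealRMK.rieszMeasure Λ) := by
    have h := hint 1
    simp only [ContinuousMap.one_apply, integral_const, smul_eq_mul, mul_one, hone] at h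
    exact ⟨(ENNReal.toReal_eq_one_iff _).1 h⟩
  exact ⟨⟨_, hprob⟩, ContinuousLinearMap.ext hint⟩

/-- The dual of a positive operator on `C(X)` has an eigenmeasure. -/
lemma exists_eigenmeasure [Nonempty X] {L : C(X, ℝ) →L[ℝ] C(X, ℝ)}
    (hL : ∀ f : C(X, ℝ), (∀ x, 0 ≤ f x) → ∀ x, 0 ≤ L f x) :
    ∃ (ν : ProbabilityMeasure X) (lam : ℝ), lam = dualOp L (toDual ν) 1 ∧
      dualOp L (toDual ν) = lam • toDual ν ∧
      Module.End.HasEigenvalue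
        (dualOp L : StrongDual ℝ C(X, ℝ) →ₗ[ℝ] StrongDual ℝ C(X, ℝ)) lam := by
  obtain ⟨l, φ, hφ, hone, hl⟩ := exists_positive_eigenfunctional hL
  obtain ⟨ν, rfl⟩ := exists_probabilityMeasure_toDual_eq φ hφ hone
  have heq : dualOp L (toDual ν) = l • toDual ν := ContinuousLinearMap.ext hl
  refine ⟨ν, l, ?_, heq, Module.End.hasEigenvalue_of_hasEigenvector (x := toDual ν) ?_⟩
  · rw [heq, smul_apply, hone, smul_eq_mul, mul_one]
  · refine ⟨Module.End.mem_eigenspace_iff.2 heq, fun h => ?_⟩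
    rw [h] at hone
    simp at hone

end PositiveOperator

/-! ### Operators given by normally convergent series. -/

section Series

variable {X ι : Type*} [TopologicalSpace X] [CompactSpace X]

/-- The bounded operator `g ↦ ∑ i, w i * g ∘ φ i` for uniformly summable nonnegative weights. -/
lemma exists_hasSum_operator {w : ι → X → ℝ} {φ : ι → X → X} {b : ι → ℝ}
    (hw : ∀ i, Continuous (w i)) (hφ : ∀ i, Continuous (φ i)) (hb : Summable b)
    (hw0 : ∀ i x, 0 ≤ w i x) (hwb : ∀ i x, w i x ≤ b i) :
    ∃ L : C(X, ℝ) →L[ℝ] C(X, ℝ),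
      ∀ g x, HasSum (fun i => w i x * g (φ i x)) (L g x) := by
  have hbound : ∀ (g : C(X, ℝ)) i x, ‖w i x * g (φ i x)‖ ≤ b i * ‖g‖ := fun g i x => by
    rw [norm_mul, Real.norm_of_nonneg (hw0 i x)]
    exact mul_le_mul (hwb i x) (g.norm_coe_le_norm _) (norm_nonneg _)
      ((hw0 i x).trans (hwb i x))
  have hsum : ∀ (g : C(X, ℝ)) x, Summable fun i => w i x * g (φ i x) := fun g x =>
    (hb.mul_right ‖g‖).of_norm_bounded fun i => hbound g i x
  let T : C(X, ℝ) →ₗ[ℝ] C(X, ℝ) :=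
    { toFun := fun g => ⟨fun x => ∑' i, w i x * g (φ i x),
        continuous_tsum (fun i => (hw i).mul (g.continuous.comp (hφ i))) (hb.mul_right ‖g‖)
          (hbound g)⟩
      map_add' := fun g h => by
        ext x
        simpa [mul_add] using (hsum g x).tsum_add (hsum h x)
      map_smul' := fun c g => by
        ext x
        simp [← tsum_mul_left, mul_left_comm] }
  -- The absolute value covers empty `X`, where `b` may be negative.
  refine ⟨T.mkContinuous (|∑' i, b i|) fun g => ?_, fun g x => (hsum g x).hasSum⟩
  rw [ContinuousMap.norm_le _ (by positivity)]
  intro x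
  calc ‖T g x‖ ≤ ∑' i, b i * ‖g‖ :=
        tsum_of_norm_bounded (hb.mul_right ‖g‖).hasSum fun i => hbound g i x
    _ = (∑' i, b i) * ‖g‖ := tsum_mul_right
    _ ≤ |∑' i, b i| * ‖g‖ := by gcongr; exact le_abs_self _

end Series

/-! ### Weights on the symbolic space. -/

section Symbolic

variable {r : ℕ}

lemma symDist_le_of_mem_cylinder {x y : Omega r} {n : ℕ} (h : y ∈ PiNat.cylinder x n) :
    symDist y x ≤ (2 : ℝ)⁻¹ ^ n := by
  unfold symDist
  split_ifs with hxy
  · positivity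
  · have := (PiNat.mem_cylinder_iff_le_firstDiff hxy n).1 h
    exact pow_le_pow_of_le_one (by norm_num) (by norm_num) (by omega)

lemma UniformlyLipschitz.continuous {A : ℕ → Omega r → ℝ} {M : ℝ}
    (hA : UniformlyLipschitz A M) (hM : 0 < M) (N : ℕ) : Continuous (A N) := by
  refine continuous_iff_continuousAt.2 fun x => Metric.tendsto_nhds.2 fun ε hε => ?_
  obtain ⟨n, hn⟩ := exists_pow_lt_of_lt_one (div_pos hε hM) (by norm_num : (2 : ℝ)⁻¹ < 1)
  filter_upwards [(PiNat.isOpen_cylinder (fun _ => Fin r) x n).mem_nhds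
    (PiNat.self_mem_cylinder x n)] with y hy
  rw [Real.dist_eq]
  calc |A N y - A N x| ≤ M * symDist y x := hA N y x
    _ ≤ M * (2 : ℝ)⁻¹ ^ n := by gcongr; exact symDist_le_of_mem_cylinder hy
    _ < ε := by rwa [mul_comm, ← lt_div_iff₀ hM]

lemma continuous_prepend (a : Fin r) : Continuous (prepend a : Omega r → Omega r) := by
  refine continuous_pi fun n => ?_
  cases n with
  | zero => exact continuous_const
  | succ n => exact continuous_apply n

/-- The Boltzmann weight `e^{-β (A_N(ax) - N μ)}` of the pair `(N, a)`. -/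
noncomputable def boltzmannWeight (A : ℕ → Omega r → ℝ) (β μ : ℝ) (p : ℕ × Fin r) (x : Omega r) : ℝ :=
  Real.exp (-β * (A p.1 (prepend p.2 x) - p.1 * μ))

/-- The slope `log r / β + μ` is what makes the exponent at most `-N log r`, after the `μ` terms
cancel. -/
lemma boltzmannWeight_le (hr : 0 < r) {A : ℕ → Omega r → ℝ} {β μ : ℝ} (hβ : 0 < β)
    (hSup : StrongSuperlinear A (Real.log r / β + μ) 0) (p : ℕ × Fin r) (x : Omega r) :
    boltzmannWeight A β μ p x ≤ (r : ℝ)⁻¹ ^ p.1 := by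
  have hr' : (0 : ℝ) < r := by exact_mod_cast hr
  have h := mul_lt_mul_of_pos_left (hSup.2 (prepend p.2 x) p.1) hβ
  have h2 : β * ((Real.log r / β + μ) * p.1 + 0) = p.1 * Real.log r + β * (p.1 * μ) := by
    field_simp
    ring
  rw [← Real.exp_log (pow_pos (inv_pos.2 hr') p.1), Real.log_pow, Real.log_inv, boltzmannWeight,
    Real.exp_le_exp]
  linarith

lemma summable_inv_pow_fst (hr : 2 ≤ r) :
    Summable fun p : ℕ × Fin r => (r : ℝ)⁻¹ ^ p.1 := by
  have hr' : (1 : ℝ) < r := by exact_mod_cast hr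
  have h := summable_geometric_of_lt_one (by positivity) (inv_lt_one_of_one_lt₀ hr')
  simpa using h.mul_of_nonneg (g := fun _ : Fin r => (1 : ℝ)) (.of_finite)
    (fun n => by positivity) (fun _ => zero_le_one)

lemma ruelleTerm_eq_sum (A : ℕ → Omega r → ℝ) (β μ : ℝ) (f x) (N : ℕ) :
    ruelleTerm A β μ f x N =
      ∑ a : Fin r, boltzmannWeight A β μ (N, a) x * f (prepend a x) := by
  rw [ruelleTerm, Finset.mul_sum]
  refine Finset.sum_congr rfl fun a _ => ?_
  rw [boltzmannWeight, ← mul_assoc, ← Real.exp_add]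
  congr 2
  ring

lemma exp_ifsWeight [NeZero r] (A : ℕ → Omega r → ℝ) (β μ : ℝ) (j : ℕ) (x : Omega r) :
    Real.exp (ifsWeight A β μ j x) = boltzmannWeight A β μ (Nat.divModEquiv r j) x := by
  have h : (j - j % r) / r = j / r := by
    rw [← Nat.mul_div_cancel_left (j / r) (NeZero.pos r)]
    congr 1
    have := Nat.div_add_mod j r
    omega
  rw [ifsWeight, h]
  rfl

end Symbolic

end GrandCanonical

open GrandCanonical in
theorem mainTheorem5 (r : ℕ) [NeZero r] (hr : 2 ≤ r) (A : ℕ → Omega r → ℝ)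
    (β μ M : ℝ) (hβ : 0 < β) (hμ : μ < 0) (hM : 0 < M)
    (hLip : UniformlyLipschitz A M)
    (hSup : StrongSuperlinear A (Real.log r / β + μ) 0) :
    ∃ L : C(Omega r, ℝ) →L[ℝ] C(Omega r, ℝ),
      IsGrandCanonicalRuelle A β μ L ∧
      IsTransferOperator (ifsMap r) (ifsWeight A β μ) L ∧
      ∃ (ν : MeasureTheory.ProbabilityMeasure (Omega r)) (lam : ℝ),
        lam = dualOp L (toDual ν) 1 ∧
        dualOp L (toDual ν) = lam • toDual ν ∧
        Module.End.HasEigenvalue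
          (dualOp L : StrongDual ℝ C(Omega r, ℝ) →ₗ[ℝ] StrongDual ℝ C(Omega r, ℝ)) lam := by
  have hA := hLip.continuous hM
  have hw0 : ∀ p x, 0 ≤ boltzmannWeight A β μ p x := fun p x => (Real.exp_pos _).le
  obtain ⟨L, hL⟩ := exists_hasSum_operator (w := boltzmannWeight A β μ)
    (φ := fun p => prepend p.2)
    (fun p => Real.continuous_exp.comp
      ((((hA p.1).comp (continuous_prepend p.2)).sub continuous_const).const_mul _))
    (fun p => continuous_prepend p.2) (summable_inv_pow_fst hr) hw0
    (boltzmannWeight_le (by omega) hβ hSup)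
  refine ⟨L, fun f x => ?_, ⟨fun j => continuous_prepend _, fun j => ?_, fun g x => ?_⟩,
    exists_eigenmeasure fun f hf x => (hL f x).nonneg fun p => mul_nonneg (hw0 p x) (hf _)⟩
  -- The sum over pairs is unconditional, so it may be grouped by `N`.
  · refine (hL f x).prod_fiberwise fun N => ?_
    rw [ruelleTerm_eq_sum]
    exact hasSum_fintype _
  · exact continuous_const.mul
      (((hA _).comp (continuous_prepend _)).sub continuous_const)
  · simp_rw [exp_ifsWeight]
    exact (Nat.divModEquiv r).hasSum_iff.2 (hL g x)
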